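/- Let $\mathbb T$ be the unit circle with normalized Lebesgue measure $\mathbf m$, $\mathbb D$ the open unit disk, and let $\omega\in L^1(\mathbb T)$ be real valued with $\gamma_1:=\operatorname{ess\,inf}\omega>-\infty$; put $\gamma_2:=\operatorname{ess\,sup}\omega\le\infty$. Let $\Lambda\subset(\gamma_1,\gamma_2)$ be an interval such that for a.e. $\lambda\in\Lambda$ the set $\Gamma(\lambda)=\{\zeta\in\mathbb T:\omega(\zeta)<\lambda\}$ is, up to a set of measure zero, a union of finitely many non-empty open arcs $(\alpha_j(\lambda),\beta_j(\lambda))$, $j=1,\dots,m(\lambda)$, with $\alpha_j(\lambda)\ne\beta_j(\lambda)$ (each arc runs counterclockwise from $\alpha_j(\lambda)$ to $\beta_j(\lambda)$), whose closures are pairwise disjoint. With $H(z)=\frac{1+z}{1-z}$, set for $z\in\mathbb D$ $$\xi(z;\lambda)=\exp\Big(-\tfrac12\int_{\mathbb T}\ln|\omega(\zeta)-\lambda|\,H(z\overline\zeta)\,d\mathbf m(\zeta)\Big)$$ (well defined for every $\lambda$ with $\ln|\omega-\lambda|\in L^1(\mathbb T)$) and $$\varphi_j(z;\lambda)=\sqrt{c_j(\lambda)}\;\xi(z;\lambda)\,\big(1-z\overline{\beta_j(\lambda)}\big)^{-1}\prod_{l=1}^{m(\lambda)}\big(1-z\overline{\alpha_l(\lambda)}\big)^{-1/2}\big(1-z\overline{\beta_l(\lambda)}\big)^{1/2},$$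 $$c_j(\lambda)=\frac1{2\pi}\prod_{l=1}^{m(\lambda)}|\beta_j(\lambda)-\alpha_l(\lambda)|\prod_{l\ne j}|\beta_j(\lambda)-\beta_l(\lambda)|^{-1},$$ with principal powers. Then: (a) for every $0<p<2$ and every bounded interval $X\subset\mathbb R$, $\ \sup_{z\in\mathbb D}\int_X|\xi(z;\lambda)|^p\,d\lambda<\infty$; (b) for a.e. $\lambda\in\Lambda$ one has $\ln|\omega-\lambda|\in L^1(\mathbb T)$, and for every $0<p<1$ and every $j=1,\dots,m(\lambda)$ the function $\varphi_j(\cdot;\lambda)$ belongs to the Hardy space $\mathbb H^p$, i.e. it is analytic in $\mathbb D$ and $\sup_{0\le r<1}\int_{\mathbb T}|\varphi_j(r\zeta;\lambda)|^p\,d\mathbf m(\zeta)<\infty$. -/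

import Mathlib

open MeasureTheory Set ComplexConjugate

noncomputable section

namespace ToeplitzEigen

/-- The unit circle carries its Borel σ-algebra. -/
instance instMeasurableSpaceCircle : MeasurableSpace Circle := borel Circle

instance instBorelSpaceCircle : BorelSpace Circle := ⟨rfl⟩

/-- Normalized Lebesgue measure `𝐦` on the unit circle: the image of `dθ / (2π)` on `(-π, π]`
under `θ ↦ exp (iθ)`. -/
def arcMeasure : Measure Circle :=
  (ENNReal.ofReal (2 * Real.pi))⁻¹ •
    (volume.restrict (Ioc (-Real.pi) Real.pi)).map Circle.exp

/-- The essential infimum `γ₁ ∈ [-∞, ∞]` of a real function on the circle. -/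
def gammaOne (ω : Circle → ℝ) : EReal := essInf (fun ζ => (ω ζ : EReal)) arcMeasure

/-- The essential supremum `γ₂ ∈ [-∞, ∞]` of a real function on the circle. -/
def gammaTwo (ω : Circle → ℝ) : EReal := essSup (fun ζ => (ω ζ : EReal)) arcMeasure

/-- Condition on the (real valued) symbol: integrable and essentially bounded from below. -/
structure IsSymbol (ω : Circle → ℝ) : Prop where
  integrable : Integrable ω arcMeasure
  bddBelow : ⊥ < gammaOne ω

/-- The set `Γ(x) = {ζ : ω ζ < x}`. -/
def sublevel (ω : Circle → ℝ) (x : ℝ) : Set Circle := {ζ | ω ζ < x}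

/-- The open arc `(a, b)` joining `a` to `b` counterclockwise (empty if `a = b`). -/
def openArc (a b : Circle) : Set Circle :=
  {ζ | ∃ s t u : ℝ, s < u ∧ u < t ∧ t < s + 2 * Real.pi ∧
    Circle.exp s = a ∧ Circle.exp t = b ∧ Circle.exp u = ζ}

/-- Up to a set of measure zero, `Γ` is the union of the `n` (nondegenerate) open arcs
`(α j, β j)`, and these arcs have pairwise disjoint closures. -/
structure IsArcDecomposition (Γ : Set Circle) {n : ℕ} (α β : Fin n → Circle) : Prop where
  ne : ∀ j, α j ≠ β j
  disjoint_closure : ∀ j l, j ≠ l →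
    Disjoint (closure (openArc (α j) (β j))) (closure (openArc (α l) (β l)))
  ae_eq : Γ =ᵐ[arcMeasure] ⋃ j, openArc (α j) (β j)

/-- The Schwarz kernel. -/
def schwarzKernel (z : ℂ) : ℂ := (1 + z) / (1 - z)

/-- `ξ(z; x) = exp (-½ ∫ ln |ω ζ - x| H(z ζ̄) d𝐦(ζ))`. -/
def xi (ω : Circle → ℝ) (z : ℂ) (x : ℝ) : ℂ :=
  Complex.exp (-(1 / 2) * ∫ ζ : Circle,
    (Real.log |ω ζ - x| : ℂ) * schwarzKernel (z * conj (ζ : ℂ)) ∂arcMeasure)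

/-- The coefficient
`c_j = (2π)⁻¹ (∏_l |β_j - α_l|) (∏_{l ≠ j} |β_j - β_l|⁻¹)`. -/
def coeffC {n : ℕ} (α β : Fin n → Circle) (j : Fin n) : ℝ :=
  (2 * Real.pi)⁻¹ * (∏ l, ‖(β j : ℂ) - α l‖) *
    ∏ l ∈ Finset.univ.erase j, ‖(β j : ℂ) - β l‖⁻¹

/-- The generalized eigenfunction
`φ_j(z; x) = √c_j ξ(z; x) (1 - z β̄_j)⁻¹ ∏_l (1 - z ᾱ_l)^(-1/2) (1 - z β̄_l)^(1/2)`,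
where the powers are principal values; for `|z| < 1` the bases have positive real part, so this is
the analytic branch equal to `1` at `z = 0`. -/
def eigenfunction (ω : Circle → ℝ) (x : ℝ) {n : ℕ} (α β : Fin n → Circle) (j : Fin n)
    (z : ℂ) : ℂ :=
  (Real.sqrt (coeffC α β j) : ℂ) * xi ω z x * (1 - z * conj (β j : ℂ))⁻¹ *
    ∏ l, (1 - z * conj (α l : ℂ)) ^ (-(1 / 2) : ℂ) * (1 - z * conj (β l : ℂ)) ^ (1 / 2 : ℂ)

/-- Membership in the Hardy space `ℍ^p` of the unit disk: `f` is analytic in `|z| < 1` and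
`sup_{0 ≤ r < 1} ∫ |f(r ζ)|^p d𝐦(ζ) < ∞`. -/
def MemHardy (p : ℝ) (f : ℂ → ℂ) : Prop :=
  DifferentiableOn ℂ f (Metric.ball 0 1) ∧
    (⨆ r ∈ Ico (0 : ℝ) 1, ∫⁻ ζ : Circle, ‖f ((r : ℂ) * ζ)‖ₑ ^ p ∂arcMeasure) < ⊤

end ToeplitzEigen

end

noncomputable section

namespace ToeplitzEigen

/-! Everything rests on one inequality. Since `|ξ(z;x)|^p` is the exponential of the Poisson average
of `-(p/2) ln|ω - x|`, Jensen's inequality for the probability measure `P_z d𝐦` gives `|ξ(z;x)|^p ≤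
∫ |ω - x|^(-p/2) P_z d𝐦` (`enorm_xi_rpow_le`).

For (a), integrate in `x` and use Tonelli: for `q = p/2 < 1` the integral of `|t - x|^(-q)` over `X`
is bounded uniformly in `t`, and `P_z` has mass one.

For (b), the same uniform bound shows that, for a.e. `x`, `|ω - x|^(-q)` is integrable on the circle
for every `0 ≤ q < 1`. Integrating the inequality over a circle of radius `r` instead, and using the
symmetry of the Poisson kernel, puts `ξ(·;x)` in every `ℍ^(2p)` with `p < 1`. The algebraic factor
of `φ_j` is at most a constant times the square root of a product of simple poles at the points
`α_l` and `β_j`, which are distinct because the arcs have disjoint closures. By the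
arithmetic-geometric mean inequality and a partial fraction estimate, `|φ_j|` is at most a constant
times `|ξ|^2 + 1` plus the sum of the moduli of these poles (`exists_norm_eigenfunction_le`). Each
simple pole is in `ℍ^p` for `p < 1`. -/

instance isProbabilityMeasure_arcMeasure : IsProbabilityMeasure arcMeasure := by
  constructor
  have hpi := Real.pi_pos
  rw [arcMeasure, Measure.smul_apply, Measure.map_apply Circle.exp.continuous.measurable
    MeasurableSet.univ, preimage_univ, Measure.restrict_apply_univ, Real.volume_Ioc, smul_eq_mul,
    show Real.pi - -Real.pi = 2 * Real.pi by ring]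
  exact ENNReal.inv_mul_cancel (by simp [hpi]) ENNReal.ofReal_ne_top

/-! ### Mean value property on the circle -/

theorem integral_arcMeasure_eq_circleAverage {f : ℂ → ℂ} (hf : Continuous fun ζ : Circle => f ζ) :
    ∫ ζ : Circle, f ζ ∂arcMeasure = Real.circleAverage f 0 1 := by
  have hpi := Real.pi_pos
  rw [arcMeasure, integral_smul_measure, integral_map Circle.exp.continuous.measurable.aemeasurable
    (hf.aestronglyMeasurable), Real.circleAverage_def,
    ← intervalIntegral.integral_of_le (by linarith)]
  have hper : Function.Periodic (fun θ : ℝ => f (circleMap 0 1 θ)) (2 * Real.pi) := fun θ => by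
    simp only [periodic_circleMap 0 1 θ]
  -- The measure is parametrized by `(-π, π]` and the circle average by `[0, 2π]`; periodicity
  -- identifies the two.
  have h := hper.intervalIntegral_add_eq (-Real.pi) 0
  rw [show -Real.pi + 2 * Real.pi = Real.pi by ring, zero_add] at h
  rw [← h, ENNReal.toReal_inv, ENNReal.toReal_ofReal (by positivity)]
  congr 1
  refine intervalIntegral.integral_congr fun θ _ => ?_
  simp [circleMap]

theorem continuous_circle_coe : Continuous fun ζ : Circle => (ζ : ℂ) :=
  continuous_subtype_val

theorem circle_coe_mem_closedBall (ζ : Circle) : (ζ : ℂ) ∈ Metric.closedBall (0 : ℂ) 1 :=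
  mem_closedBall_zero_iff.2 ζ.norm_coe.le

theorem integral_arcMeasure_eq_apply_zero {f : ℂ → ℂ}
    (hf : DifferentiableOn ℂ f (Metric.closedBall 0 1)) :
    ∫ ζ : Circle, f ζ ∂arcMeasure = f 0 := by
  rw [integral_arcMeasure_eq_circleAverage]
  · refine DiffContOnCl.circleAverage (f := f) (c := 0) (R := 1) ⟨?_, ?_⟩
    · rw [abs_one]
      exact hf.mono Metric.ball_subset_closedBall
    · rw [abs_one, closure_ball _ one_ne_zero]
      exact hf.continuousOn
  · exact hf.continuousOn.comp_continuous continuous_circle_coe circle_coe_mem_closedBall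

/-! ### Schwarz and Poisson kernels -/

theorem re_one_sub_pos {w : ℂ} (hw : ‖w‖ < 1) : 0 < (1 - w).re := by
  have := (Complex.abs_re_le_norm w).trans_lt hw
  rw [abs_lt] at this
  simp only [Complex.sub_re, Complex.one_re]
  linarith

theorem one_sub_mem_slitPlane {w : ℂ} (hw : ‖w‖ < 1) : 1 - w ∈ Complex.slitPlane :=
  Or.inl (re_one_sub_pos hw)

theorem one_sub_ne_zero {w : ℂ} (hw : ‖w‖ < 1) : 1 - w ≠ 0 :=
  Complex.slitPlane_ne_zero (one_sub_mem_slitPlane hw)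

theorem re_schwarzKernel (w : ℂ) :
    (schwarzKernel w).re = (1 - ‖w‖ ^ 2) / ‖1 - w‖ ^ 2 := by
  rw [schwarzKernel, Complex.div_re, ← Complex.normSq_eq_norm_sq, ← Complex.normSq_eq_norm_sq,
    ← add_div]
  congr 1
  simp [Complex.normSq_apply]
  ring

theorem re_schwarzKernel_nonneg {w : ℂ} (hw : ‖w‖ < 1) : 0 ≤ (schwarzKernel w).re := by
  rw [re_schwarzKernel]
  have : ‖w‖ ^ 2 ≤ 1 := pow_le_one₀ (norm_nonneg _) hw.le
  exact div_nonneg (by linarith) (by positivity)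

theorem norm_mul_coe_lt {w : ℂ} (hw : ‖w‖ < 1) {ζ : ℂ} (hζ : ‖ζ‖ ≤ 1) : ‖w * ζ‖ < 1 := by
  rw [norm_mul]
  exact (mul_le_of_le_one_right (norm_nonneg _) hζ).trans_lt hw

theorem norm_mul_conj_lt {z : ℂ} (hz : ‖z‖ < 1) (ζ : Circle) : ‖z * conj (ζ : ℂ)‖ < 1 :=
  norm_mul_coe_lt hz ((Complex.norm_conj _).trans ζ.norm_coe).le

theorem differentiableAt_schwarzKernel {w : ℂ} (hw : ‖w‖ < 1) :
    DifferentiableAt ℂ schwarzKernel w := by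
  have : 1 - w ≠ 0 := one_sub_ne_zero hw
  unfold schwarzKernel
  fun_prop (disch := assumption)

theorem differentiableOn_schwarzKernel_mul {w : ℂ} (hw : ‖w‖ < 1) :
    DifferentiableOn ℂ (fun ζ => schwarzKernel (w * ζ)) (Metric.closedBall 0 1) := fun ζ hζ => by
  refine DifferentiableAt.differentiableWithinAt ?_
  exact (differentiableAt_schwarzKernel (norm_mul_coe_lt hw (by simpa using hζ))).comp ζ
    (differentiableAt_id.const_mul w)

theorem continuous_schwarzKernel_mul {w : ℂ} (hw : ‖w‖ < 1) :
    Continuous fun ζ : Circle => schwarzKernel (w * ζ) :=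
  (differentiableOn_schwarzKernel_mul hw).continuousOn.comp_continuous continuous_circle_coe
    circle_coe_mem_closedBall

theorem integral_re_schwarzKernel_mul {w : ℂ} (hw : ‖w‖ < 1) :
    ∫ ζ : Circle, (schwarzKernel (w * ζ)).re ∂arcMeasure = 1 := by
  have hint : Integrable (fun ζ : Circle => schwarzKernel (w * ζ)) arcMeasure :=
    (continuous_schwarzKernel_mul hw).integrable_of_hasCompactSupport
      (HasCompactSupport.of_compactSpace _)
  have h := integral_arcMeasure_eq_apply_zero (differentiableOn_schwarzKernel_mul hw)
  have h2 : ∫ ζ : Circle, (schwarzKernel (w * ζ)).re ∂arcMeasure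
      = (∫ ζ : Circle, schwarzKernel (w * ζ) ∂arcMeasure).re := integral_re hint
  rw [h2, h]
  simp [schwarzKernel]

/-- The Poisson kernel of the disk, as an extended nonnegative real. -/
def poisson (z : ℂ) (ζ : Circle) : ENNReal :=
  ENNReal.ofReal (schwarzKernel (z * conj (ζ : ℂ))).re

/-- The two arguments of the kernel are complex conjugates. The symmetry lets the total mass one be
used when integrating over the point of the disk. -/
theorem poisson_comm (r : ℝ) (ζ η : Circle) :
    poisson ((r : ℂ) * ζ) η = poisson ((r : ℂ) * η) ζ := by
  unfold poisson
  rw [re_schwarzKernel, re_schwarzKernel]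
  have h : (r : ℂ) * η * conj (ζ : ℂ) = conj ((r : ℂ) * ζ * conj (η : ℂ)) := by
    simp only [map_mul, Complex.conj_conj, Complex.conj_ofReal]
    ring
  have h' : 1 - conj ((r : ℂ) * ζ * conj (η : ℂ)) = conj (1 - (r : ℂ) * ζ * conj (η : ℂ)) := by
    simp
  rw [h, h', Complex.norm_conj, Complex.norm_conj]

theorem continuous_schwarzKernel_conj {z : ℂ} (hz : ‖z‖ < 1) :
    Continuous fun ζ : Circle => schwarzKernel (z * conj (ζ : ℂ)) := by
  refine continuous_iff_continuousAt.2 fun ζ => ?_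
  exact ContinuousAt.comp (f := fun ζ : Circle => z * conj (ζ : ℂ)) (g := schwarzKernel)
    (differentiableAt_schwarzKernel (norm_mul_conj_lt hz ζ)).continuousAt
    (by fun_prop)

theorem measurable_poisson {z : ℂ} (hz : ‖z‖ < 1) : Measurable (poisson z) :=
  (ENNReal.continuous_ofReal.comp
    (Complex.continuous_re.comp (continuous_schwarzKernel_conj hz))).measurable

theorem re_schwarzKernel_conj (w : ℂ) : (schwarzKernel (conj w)).re = (schwarzKernel w).re := by
  have h' : 1 - conj w = conj (1 - w) := by simp
  rw [re_schwarzKernel, re_schwarzKernel, h', Complex.norm_conj, Complex.norm_conj]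

theorem integral_re_schwarzKernel_conj {z : ℂ} (hz : ‖z‖ < 1) :
    ∫ ζ : Circle, (schwarzKernel (z * conj (ζ : ℂ))).re ∂arcMeasure = 1 := by
  rw [← integral_re_schwarzKernel_mul (w := conj z) (by simpa using hz)]
  congr 1 with ζ
  rw [← re_schwarzKernel_conj]
  simp

theorem lintegral_poisson {z : ℂ} (hz : ‖z‖ < 1) : ∫⁻ ζ, poisson z ζ ∂arcMeasure = 1 := by
  unfold poisson
  rw [← ofReal_integral_eq_lintegral_ofReal, integral_re_schwarzKernel_conj hz, ENNReal.ofReal_one]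
  · exact (Complex.continuous_re.comp
      (continuous_schwarzKernel_conj hz)).integrable_of_hasCompactSupport
      (HasCompactSupport.of_compactSpace _)
  · exact Filter.Eventually.of_forall fun ζ => re_schwarzKernel_nonneg (norm_mul_conj_lt hz ζ)

/-! ### Simple poles in the Hardy space -/

theorem cos_mul_norm_rpow_le_re_cpow {w : ℂ} (hw : 0 < w.re) {p : ℝ} (hp0 : 0 ≤ p) (hp1 : p ≤ 1) :
    Real.cos (p * (Real.pi / 2)) * ‖w‖ ^ (-p) ≤ (w ^ (-p : ℂ)).re := by
  have hw0 : w ≠ 0 := by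
    rintro rfl
    simp at hw
  have harg := (Complex.abs_arg_lt_pi_div_two_iff.2 (Or.inl hw)).le
  have hn := norm_pos_iff.2 hw0
  have hexp : Complex.log w * (-p : ℂ) = ((Real.log ‖w‖ * (-p) : ℝ) : ℂ)
      + ((-(p * Complex.arg w) : ℝ) : ℂ) * Complex.I := by
    rw [Complex.log]
    push_cast
    ring
  rw [Complex.cpow_def_of_ne_zero hw0, hexp, Complex.exp_add, ← Complex.ofReal_exp,
    Complex.re_ofReal_mul, Complex.exp_ofReal_mul_I_re, Real.cos_neg, ← Real.rpow_def_of_pos hn,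
    mul_comm]
  refine mul_le_mul_of_nonneg_left ?_ (by positivity)
  -- In the right half plane `|arg w| ≤ π/2`, so the argument of the power stays in the sector of
  -- half-angle `pπ/2`, and the cosine decreases on `[0, π]`.
  rw [← Real.cos_abs (p * w.arg), abs_mul, abs_of_nonneg hp0]
  refine Real.cos_le_cos_of_nonneg_of_le_pi (by positivity) ?_ ?_
  · nlinarith [Real.pi_pos]
  · exact mul_le_mul_of_nonneg_left harg hp0

/-- The functions `(1 - z ā)⁻¹` belong to `ℍ^p` for `p < 1`. -/
theorem lintegral_one_sub_rpow_le {p : ℝ} (hp0 : 0 < p) (hp1 : p < 1) {w : ℂ} (hw : ‖w‖ < 1) :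
    ∫⁻ ζ : Circle, ‖1 - w * ζ‖ₑ ^ (-p) ∂arcMeasure
      ≤ ENNReal.ofReal (Real.cos (p * (Real.pi / 2)))⁻¹ := by
  have hpi := Real.pi_pos
  have hcos : 0 < Real.cos (p * (Real.pi / 2)) :=
    Real.cos_pos_of_mem_Ioo ⟨by nlinarith, by nlinarith⟩
  have hd : DifferentiableOn ℂ (fun ζ => (1 - w * ζ) ^ (-p : ℂ)) (Metric.closedBall 0 1) :=
    fun ζ hζ => by
      have := one_sub_mem_slitPlane (norm_mul_coe_lt hw (ζ := ζ) (by simpa using hζ))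
      have h : DifferentiableAt ℂ (fun ζ : ℂ => 1 - w * ζ) ζ := by fun_prop
      exact (h.cpow_const this).differentiableWithinAt
  have hcont : Continuous fun ζ : Circle => (1 - w * ζ) ^ (-p : ℂ) :=
    hd.continuousOn.comp_continuous continuous_circle_coe circle_coe_mem_closedBall
  have hint : Integrable (fun ζ : Circle => (1 - w * ζ) ^ (-p : ℂ)) arcMeasure :=
    hcont.integrable_of_hasCompactSupport (HasCompactSupport.of_compactSpace _)
  have h1 : ∫ ζ : Circle, ((1 - w * ζ) ^ (-p : ℂ)).re ∂arcMeasure = 1 := by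
    have h2 : ∫ ζ : Circle, ((1 - w * ζ) ^ (-p : ℂ)).re ∂arcMeasure
      = (∫ ζ : Circle, (1 - w * ζ) ^ (-p : ℂ) ∂arcMeasure).re := integral_re hint
    rw [h2, integral_arcMeasure_eq_apply_zero hd]
    simp
  have hle : ∀ ζ : Circle, ‖1 - w * ζ‖ ^ (-p)
      ≤ (Real.cos (p * (Real.pi / 2)))⁻¹ * ((1 - w * ζ) ^ (-p : ℂ)).re := fun ζ => by
    rw [inv_mul_eq_div, le_div_iff₀ hcos, mul_comm]
    exact cos_mul_norm_rpow_le_re_cpow (re_one_sub_pos (norm_mul_coe_lt hw ζ.norm_coe.le)) hp0.le hp1.le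
  calc ∫⁻ ζ : Circle, ‖1 - w * ζ‖ₑ ^ (-p) ∂arcMeasure
      ≤ ∫⁻ ζ : Circle, ENNReal.ofReal
          ((Real.cos (p * (Real.pi / 2)))⁻¹ * ((1 - w * ζ) ^ (-p : ℂ)).re) ∂arcMeasure := by
        refine lintegral_mono fun ζ => ?_
        have h0 : 0 < ‖1 - w * ζ‖ :=
          norm_pos_iff.2 (one_sub_ne_zero (norm_mul_coe_lt hw ζ.norm_coe.le))
        rw [← ofReal_norm, ENNReal.ofReal_rpow_of_pos h0]
        exact ENNReal.ofReal_le_ofReal (hle ζ)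
    _ = ENNReal.ofReal (Real.cos (p * (Real.pi / 2)))⁻¹ := by
        rw [← ofReal_integral_eq_lintegral_ofReal, integral_const_mul, h1, mul_one]
        · exact hint.re.const_mul _
        · exact Filter.Eventually.of_forall fun ζ => (by positivity : (0:ℝ) ≤ _).trans (hle ζ)

/-! ### Power singularities, Jensen's inequality, bounds for the logarithm -/

theorem lintegral_Icc_enorm_rpow_lt_top {q : ℝ} (hq : q < 1) :
    ∫⁻ x in Icc (-1 : ℝ) 1, ‖x‖ₑ ^ (-q) < ⊤ := by
  have h1 : IntervalIntegrable (fun x : ℝ => |x| ^ (-q)) volume 0 1 := by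
    refine (intervalIntegral.intervalIntegrable_rpow' (r := -q) (by linarith)).congr
      fun x hx => ?_
    rw [uIoc_of_le zero_le_one] at hx
    simp only [abs_of_pos hx.1]
  have h2 : IntervalIntegrable (fun x : ℝ => |x| ^ (-q)) volume (-1) 0 := by
    rw [IntervalIntegrable.iff_comp_neg]
    simpa using h1.symm
  have h3 := h2.trans h1
  rw [intervalIntegrable_iff_integrableOn_Icc_of_le (by norm_num)] at h3
  refine lt_of_eq_of_lt ?_ h3.2
  refine setLIntegral_congr_fun_ae measurableSet_Icc ?_
  -- At `0` a negative power is `⊤` in `ENNReal` but finite in `ℝ`, so the integrands agree only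
  -- almost everywhere.
  have h0 : ∀ᵐ x : ℝ, x ≠ 0 := by simp [ae_iff]
  filter_upwards [h0] with x hx _
  rw [← ofReal_norm, ENNReal.ofReal_rpow_of_pos (norm_pos_iff.2 hx), Real.norm_eq_abs,
    Real.enorm_eq_ofReal (by positivity)]

/-- Where `|t - x| > 1` the integrand is at most one; the rest is translated to the origin. The
point is that the bound does not depend on `t`. -/
theorem setLIntegral_enorm_sub_rpow_le {q : ℝ} (hq0 : 0 ≤ q) (t : ℝ) (X : Set ℝ) :
    ∫⁻ x in X, ‖t - x‖ₑ ^ (-q)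
      ≤ (∫⁻ x in Icc (-1 : ℝ) 1, ‖x‖ₑ ^ (-q)) + volume X := by
  have hle : ∀ y : ℝ, ‖y‖ₑ ^ (-q) ≤ (Icc (-1 : ℝ) 1).indicator (fun x => ‖x‖ₑ ^ (-q)) y + 1 := by
    intro y
    by_cases hy : y ∈ Icc (-1 : ℝ) 1
    · rw [indicator_of_mem hy]
      exact le_self_add
    · rw [indicator_of_notMem hy, zero_add]
      have h1 : 1 ≤ ‖y‖ₑ := by
        rw [← ofReal_norm, ENNReal.one_le_ofReal, Real.norm_eq_abs]
        exact le_of_lt (not_le.1 fun h => hy (abs_le.1 h))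
      exact (ENNReal.rpow_le_rpow_of_exponent_le h1 (by linarith : -q ≤ 0)).trans
        (ENNReal.rpow_zero).le
  have hm : Measurable fun x : ℝ => (Icc (-1 : ℝ) 1).indicator (fun x => ‖x‖ₑ ^ (-q)) x :=
    Measurable.indicator (by fun_prop) measurableSet_Icc
  calc ∫⁻ x in X, ‖t - x‖ₑ ^ (-q)
      ≤ ∫⁻ x in X, ((Icc (-1 : ℝ) 1).indicator (fun x => ‖x‖ₑ ^ (-q)) (t - x) + 1) :=
        lintegral_mono fun x => hle (t - x)
    _ = (∫⁻ x in X, (Icc (-1 : ℝ) 1).indicator (fun x => ‖x‖ₑ ^ (-q)) (t - x)) + volume X := by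
        rw [lintegral_add_right _ measurable_const, setLIntegral_one]
    _ ≤ (∫⁻ x : ℝ, (Icc (-1 : ℝ) 1).indicator (fun x => ‖x‖ₑ ^ (-q)) (t - x)) + volume X := by
        gcongr
        exact Measure.restrict_le_self
    _ = _ := by
        rw [lintegral_sub_left_eq_self, lintegral_indicator measurableSet_Icc]

theorem ofReal_exp_integral_le {Ω : Type*} [MeasurableSpace Ω] {ν : Measure Ω}
    [IsProbabilityMeasure ν] {f : Ω → ℝ} (hf : Integrable f ν) :
    ENNReal.ofReal (Real.exp (∫ x, f x ∂ν)) ≤ ∫⁻ x, ENNReal.ofReal (Real.exp (f x)) ∂ν := by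
  by_cases h : ∫⁻ x, ENNReal.ofReal (Real.exp (f x)) ∂ν = ⊤
  · rw [h]
    exact le_top
  · have hint : Integrable (fun x => Real.exp (f x)) ν := by
      refine ⟨Real.continuous_exp.comp_aestronglyMeasurable hf.1, ?_⟩
      rw [hasFiniteIntegral_iff_ofReal (Filter.Eventually.of_forall fun x => (Real.exp_pos _).le)]
      exact lt_top_iff_ne_top.2 h
    rw [← ofReal_integral_eq_lintegral_ofReal hint
      (Filter.Eventually.of_forall fun x => (Real.exp_pos _).le)]
    exact ENNReal.ofReal_le_ofReal (convexOn_exp.map_integral_le Real.continuous_exp.continuousOn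
      isClosed_univ (by simp) hf hint)

/-- With `t = ω - x`, the first term is integrable because `ω` is, and the second for a.e. `x`
because its exponent exceeds `-1`. -/
theorem abs_log_abs_le (t : ℝ) (ht : t ≠ 0) :
    |Real.log (|t|)| ≤ |t| + 2 * |t| ^ (-(1 / 2) : ℝ) := by
  have h0 : 0 < |t| := abs_pos.2 ht
  have h1 : Real.log |t| ≤ |t| := (Real.log_le_sub_one_of_pos h0).trans (by linarith)
  have h2 := Real.log_le_rpow_div (inv_nonneg.2 h0.le) (ε := 1 / 2) (by norm_num)
  rw [Real.log_inv, Real.inv_rpow h0.le, ← Real.rpow_neg h0.le] at h2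
  have h3 : 0 < |t| ^ (-(1 / 2) : ℝ) := by positivity
  rw [abs_le]
  constructor <;> linarith

theorem ofReal_exp_neg_mul_log_le {q : ℝ} (hq : 0 < q) (t : ℝ) :
    ENNReal.ofReal (Real.exp (-q * Real.log |t|)) ≤ ‖t‖ₑ ^ (-q) := by
  rcases eq_or_ne t 0 with rfl | ht
  -- The convention `Real.log 0 = 0` makes the left side one here, which is harmless since the right
  -- side is `⊤`.
  · rw [enorm_zero, ENNReal.zero_rpow_of_neg (by linarith)]
    exact le_top
  · have h0 : 0 < |t| := abs_pos.2 ht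
    rw [← ofReal_norm, Real.norm_eq_abs, ENNReal.ofReal_rpow_of_pos h0, Real.rpow_def_of_pos h0,
      mul_comm]

/-! ### Negative powers of the shifted symbol -/

variable {ω : Circle → ℝ}

theorem aemeasurable_enorm_sub_rpow (hω : AEMeasurable ω arcMeasure) (q : ℝ) (μ : Measure ℝ)
    [SFinite μ] :
    AEMeasurable (fun y : ℝ × Circle => ‖ω y.2 - y.1‖ₑ ^ (-q)) (μ.prod arcMeasure) := by
  have h : AEMeasurable (fun y : ℝ × Circle => ω y.2) (μ.prod arcMeasure) := hω.comp_snd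
  exact ((h.sub measurable_fst.aemeasurable).enorm).pow_const _

theorem ae_lintegral_enorm_sub_rpow_lt_top (hω : AEMeasurable ω arcMeasure) {q : ℝ}
    (hq0 : 0 ≤ q) (hq1 : q < 1) :
    ∀ᵐ x : ℝ, ∫⁻ ζ, ‖ω ζ - x‖ₑ ^ (-q) ∂arcMeasure < ⊤ := by
  have key : ∀ n : ℕ, ∀ᵐ x ∂(volume.restrict (Icc (-n : ℝ) n)),
      ∫⁻ ζ, ‖ω ζ - x‖ₑ ^ (-q) ∂arcMeasure < ⊤ := fun n => by
    have hm := aemeasurable_enorm_sub_rpow hω q (volume.restrict (Icc (-n : ℝ) n))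
    refine ae_lt_top' hm.lintegral_prod_right' ?_
    rw [lintegral_lintegral_swap (f := fun x ζ => ‖ω ζ - x‖ₑ ^ (-q)) hm]
    refine ne_top_of_le_ne_top ?_ (lintegral_mono fun ζ =>
      setLIntegral_enorm_sub_rpow_le hq0 (ω ζ) (Icc (-n : ℝ) n))
    rw [lintegral_const, measure_univ, mul_one, Real.volume_Icc]
    exact ENNReal.add_ne_top.2 ⟨(lintegral_Icc_enorm_rpow_lt_top hq1).ne, ENNReal.ofReal_ne_top⟩
  have hall := ae_all_iff.2 fun n => ae_imp_of_ae_restrict (key n)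
  filter_upwards [hall] with x hx
  obtain ⟨n, hn⟩ := exists_nat_ge |x|
  exact hx n (abs_le.1 hn)

theorem enorm_rpow_neg_le_of_le {q q' : ℝ} (hq : 0 ≤ q) (hqq : q ≤ q') (t : ℝ) :
    ‖t‖ₑ ^ (-q) ≤ 1 + ‖t‖ₑ ^ (-q') := by
  rcases le_total ‖t‖ₑ 1 with h | h
  · exact (ENNReal.rpow_le_rpow_of_exponent_ge h (by linarith)).trans le_add_self
  · exact (ENNReal.rpow_le_rpow_of_exponent_le h (by linarith : -q ≤ 0)).trans
      (by rw [ENNReal.rpow_zero]; exact le_self_add)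

theorem ae_forall_lintegral_enorm_sub_rpow_lt_top (hω : AEMeasurable ω arcMeasure) :
    ∀ᵐ x : ℝ, ∀ q : ℝ, 0 ≤ q → q < 1 → ∫⁻ ζ, ‖ω ζ - x‖ₑ ^ (-q) ∂arcMeasure < ⊤ := by
  have h : ∀ n : ℕ, ∀ᵐ x : ℝ, ∫⁻ ζ, ‖ω ζ - x‖ₑ ^ (-(1 - 1 / ((n : ℝ) + 1))) ∂arcMeasure < ⊤ :=
    fun n => by
      have h1 : 1 / ((n : ℝ) + 1) ≤ 1 := by
        rw [div_le_one (by positivity)]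
        linarith [n.cast_nonneg (α := ℝ)]
      have h2 : 0 < 1 / ((n : ℝ) + 1) := by positivity
      exact ae_lintegral_enorm_sub_rpow_lt_top hω (by linarith) (by linarith)
  filter_upwards [ae_all_iff.2 h] with x hx q hq0 hq1
  obtain ⟨n, hn⟩ := exists_nat_one_div_lt (sub_pos.2 hq1)
  -- Countably many exponents increasing to one share a null set; any other `q < 1` is dominated by
  -- one of them.
  refine (lintegral_mono fun ζ => enorm_rpow_neg_le_of_le hq0
    (q' := 1 - 1 / ((n : ℝ) + 1)) (by linarith) (ω ζ - x)).trans_lt ?_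
  rw [lintegral_add_left measurable_const, lintegral_const, measure_univ, mul_one]
  exact ENNReal.add_lt_top.2 ⟨ENNReal.one_lt_top, hx n⟩

theorem integrable_log_abs_sub (hω : Integrable ω arcMeasure) {x : ℝ}
    (hx : ∫⁻ ζ, ‖ω ζ - x‖ₑ ^ (-(1 / 2) : ℝ) ∂arcMeasure < ⊤) :
    Integrable (fun ζ => Real.log |ω ζ - x|) arcMeasure := by
  have hsub : Integrable (fun ζ => ω ζ - x) arcMeasure := hω.sub (integrable_const x)
  have hm := hsub.1.aemeasurable
  have hle : ∀ t : ℝ, ‖Real.log (|t|)‖ₑ ≤ ‖t‖ₑ + 2 * ‖t‖ₑ ^ (-(1 / 2) : ℝ) := fun t => by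
    rcases eq_or_ne t 0 with rfl | ht
    · simp
    · have h0 : 0 < |t| := abs_pos.2 ht
      rw [← ofReal_norm, ← ofReal_norm, Real.norm_eq_abs, Real.norm_eq_abs,
        ENNReal.ofReal_rpow_of_pos h0, ← ENNReal.ofReal_ofNat 2, ← ENNReal.ofReal_mul (by norm_num),
        ← ENNReal.ofReal_add (by positivity) (by positivity)]
      exact ENNReal.ofReal_le_ofReal (abs_log_abs_le t ht)
  refine ⟨(Real.measurable_log.comp_aemeasurable
    (continuous_abs.measurable.comp_aemeasurable hm)).aestronglyMeasurable, ?_⟩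
  refine (lintegral_mono fun ζ => hle (ω ζ - x)).trans_lt ?_
  rw [lintegral_add_left' hm.enorm, lintegral_const_mul'' _ (hm.enorm.pow_const _)]
  exact ENNReal.add_lt_top.2 ⟨hsub.2, ENNReal.mul_lt_top (by simp) hx⟩

theorem integrable_log_mul_schwarzKernel {x : ℝ}
    (hL : Integrable (fun ζ => Real.log |ω ζ - x|) arcMeasure) {z : ℂ} (hz : ‖z‖ < 1) :
    Integrable (fun ζ : Circle => (Real.log |ω ζ - x| : ℂ) * schwarzKernel (z * conj (ζ : ℂ)))
      arcMeasure := by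
  have hc := continuous_schwarzKernel_conj hz
  obtain ⟨C, hC⟩ := (isCompact_range hc).isBounded.exists_norm_le
  exact hL.ofReal.mul_bdd (c := C) hc.aestronglyMeasurable
    (Filter.Eventually.of_forall fun ζ => hC _ ⟨ζ, rfl⟩)

/-! ### Bounds and analyticity of `xi` -/

theorem norm_xi {x : ℝ} (hL : Integrable (fun ζ => Real.log |ω ζ - x|) arcMeasure) {z : ℂ}
    (hz : ‖z‖ < 1) :
    ‖xi ω z x‖ = Real.exp (-(1 / 2) *
      ∫ ζ : Circle, Real.log |ω ζ - x| * (schwarzKernel (z * conj (ζ : ℂ))).re ∂arcMeasure) := by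
  have h : ∫ ζ : Circle, Real.log |ω ζ - x| * (schwarzKernel (z * conj (ζ : ℂ))).re ∂arcMeasure
      = (∫ ζ : Circle, (Real.log |ω ζ - x| : ℂ) * schwarzKernel (z * conj (ζ : ℂ)) ∂arcMeasure).re := by
    rw [← RCLike.re_eq_complex_re, ← integral_re (integrable_log_mul_schwarzKernel hL hz)]
    congr 1 with ζ
    rw [RCLike.re_eq_complex_re, Complex.re_ofReal_mul]
  rw [xi, Complex.norm_exp, h, ← Complex.re_ofReal_mul]
  norm_num

theorem isProbabilityMeasure_withDensity_poisson {z : ℂ} (hz : ‖z‖ < 1) :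
    IsProbabilityMeasure (arcMeasure.withDensity (poisson z)) :=
  ⟨by rw [withDensity_apply _ MeasurableSet.univ, Measure.restrict_univ, lintegral_poisson hz]⟩

/-- Jensen's inequality for the exponential and the probability measure with density `poisson z`. -/
theorem enorm_xi_rpow_le {x : ℝ} (hL : Integrable (fun ζ => Real.log |ω ζ - x|) arcMeasure)
    (hω : AEMeasurable ω arcMeasure) {p : ℝ} (hp : 0 < p) {z : ℂ} (hz : ‖z‖ < 1) :
    ‖xi ω z x‖ₑ ^ p ≤ ∫⁻ ζ, ‖ω ζ - x‖ₑ ^ (-(p / 2)) * poisson z ζ ∂arcMeasure := by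
  have := isProbabilityMeasure_withDensity_poisson hz
  have hP := measurable_poisson hz
  have hPtop : ∀ᵐ ζ ∂arcMeasure, poisson z ζ < ⊤ :=
    Filter.Eventually.of_forall fun _ => ENNReal.ofReal_lt_top
  have htoReal : ∀ ζ, (poisson z ζ).toReal = (schwarzKernel (z * conj (ζ : ℂ))).re := fun ζ =>
    ENNReal.toReal_ofReal (re_schwarzKernel_nonneg (norm_mul_conj_lt hz ζ))
  have hI : Integrable (fun ζ : Circle => Real.log |ω ζ - x| *
      (schwarzKernel (z * conj (ζ : ℂ))).re) arcMeasure := by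
    refine (integrable_log_mul_schwarzKernel hL hz).re.congr
      (Filter.Eventually.of_forall fun ζ => ?_)
    simp only [RCLike.re_eq_complex_re, Complex.re_ofReal_mul]
  have hsmul : ∀ ζ, (poisson z ζ).toReal • (-(p / 2) * Real.log |ω ζ - x|)
      = -(p / 2) * (Real.log |ω ζ - x| * (schwarzKernel (z * conj (ζ : ℂ))).re) := fun ζ => by
    rw [htoReal, smul_eq_mul]
    ring
  have hν : Integrable (fun ζ => -(p / 2) * Real.log |ω ζ - x|)
      (arcMeasure.withDensity (poisson z)) := by
    rw [integrable_withDensity_iff_integrable_smul' hP hPtop]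
    simp_rw [hsmul]
    exact hI.const_mul _
  have hm : AEMeasurable (fun ζ => ω ζ - x) arcMeasure := hω.sub aemeasurable_const
  have h := ofReal_exp_integral_le hν
  rw [integral_withDensity_eq_integral_toReal_smul hP hPtop] at h
  simp_rw [hsmul] at h
  rw [integral_const_mul] at h
  calc ‖xi ω z x‖ₑ ^ p = _ := by
        rw [← ofReal_norm, norm_xi hL hz, ENNReal.ofReal_rpow_of_pos (Real.exp_pos _),
          ← Real.exp_mul]
        congr 2
        ring
    _ ≤ _ := h
    _ ≤ ∫⁻ ζ, ‖ω ζ - x‖ₑ ^ (-(p / 2)) ∂(arcMeasure.withDensity (poisson z)) :=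
        lintegral_mono fun ζ => ofReal_exp_neg_mul_log_le (by positivity) _
    _ = _ := by
        rw [lintegral_withDensity_eq_lintegral_mul₀ hP.aemeasurable (hm.enorm.pow_const _)]
        simp only [Pi.mul_apply, mul_comm]

theorem setLIntegral_enorm_xi_rpow_le (hω : Integrable ω arcMeasure) {p : ℝ} (hp : 0 < p)
    {z : ℂ} (hz : ‖z‖ < 1) (X : Set ℝ) :
    ∫⁻ x in X, ‖xi ω z x‖ₑ ^ p
      ≤ (∫⁻ x in Icc (-1 : ℝ) 1, ‖x‖ₑ ^ (-(p / 2))) + volume X := by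
  have hm := aemeasurable_enorm_sub_rpow hω.1.aemeasurable (p / 2) (volume.restrict X)
  have hP : Measurable fun y : ℝ × Circle => poisson z y.2 := (measurable_poisson hz).comp measurable_snd
  calc ∫⁻ x in X, ‖xi ω z x‖ₑ ^ p
      ≤ ∫⁻ x in X, ∫⁻ ζ, ‖ω ζ - x‖ₑ ^ (-(p / 2)) * poisson z ζ ∂arcMeasure := by
        refine lintegral_mono_ae (ae_restrict_of_ae ?_)
        filter_upwards [ae_forall_lintegral_enorm_sub_rpow_lt_top hω.1.aemeasurable] with x hx
        exact enorm_xi_rpow_le (integrable_log_abs_sub hω (hx _ (by norm_num) (by norm_num)))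
          hω.1.aemeasurable hp hz
    _ = ∫⁻ ζ, (∫⁻ x in X, ‖ω ζ - x‖ₑ ^ (-(p / 2)) * poisson z ζ) ∂arcMeasure :=
        lintegral_lintegral_swap (hm.mul hP.aemeasurable)
    _ = ∫⁻ ζ, (∫⁻ x in X, ‖ω ζ - x‖ₑ ^ (-(p / 2))) * poisson z ζ ∂arcMeasure := by
        refine lintegral_congr fun ζ => lintegral_mul_const _ ?_
        fun_prop
    _ ≤ ∫⁻ ζ, ((∫⁻ x in Icc (-1 : ℝ) 1, ‖x‖ₑ ^ (-(p / 2))) + volume X) * poisson z ζ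
          ∂arcMeasure := by
        refine lintegral_mono fun ζ => mul_le_mul_left ?_ _
        exact setLIntegral_enorm_sub_rpow_le (by positivity) _ _
    _ = _ := by
        rw [lintegral_const_mul _ (measurable_poisson hz), lintegral_poisson hz, mul_one]

theorem norm_ofReal_mul_circle_lt {r : ℝ} (hr : r ∈ Ico (0 : ℝ) 1) (ζ : Circle) :
    ‖(r : ℂ) * ζ‖ < 1 :=
  norm_mul_coe_lt (by rw [Complex.norm_real, Real.norm_of_nonneg hr.1]; exact hr.2) ζ.norm_coe.le

theorem measurable_poisson_uncurry {r : ℝ} (hr : r ∈ Ico (0 : ℝ) 1) :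
    Measurable fun y : Circle × Circle => poisson ((r : ℂ) * y.1) y.2 := by
  refine Continuous.measurable (continuous_iff_continuousAt.2 fun y => ?_)
  have h1 : ContinuousAt (fun y : Circle × Circle => (r : ℂ) * y.1 * conj (y.2 : ℂ)) y :=
    ((continuous_const.mul (continuous_circle_coe.comp continuous_fst)).mul
      (Complex.continuous_conj.comp (continuous_circle_coe.comp continuous_snd))).continuousAt
  have h2 : ContinuousAt schwarzKernel ((r : ℂ) * y.1 * conj (y.2 : ℂ)) :=
    (differentiableAt_schwarzKernel
      (norm_mul_conj_lt (norm_ofReal_mul_circle_lt hr y.1) y.2)).continuousAt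
  exact (ENNReal.continuous_ofReal.comp Complex.continuous_re).continuousAt.comp
    (ContinuousAt.comp (f := fun y : Circle × Circle => (r : ℂ) * y.1 * conj (y.2 : ℂ)) h2 h1)

theorem lintegral_enorm_xi_rpow_le {x : ℝ}
    (hL : Integrable (fun ζ => Real.log |ω ζ - x|) arcMeasure)
    (hω : AEMeasurable ω arcMeasure) {p : ℝ} (hp : 0 < p) {r : ℝ} (hr : r ∈ Ico (0 : ℝ) 1) :
    ∫⁻ η : Circle, ‖xi ω ((r : ℂ) * η) x‖ₑ ^ p ∂arcMeasure
      ≤ ∫⁻ ζ, ‖ω ζ - x‖ₑ ^ (-(p / 2)) ∂arcMeasure := by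
  have hm : AEMeasurable (fun ζ => ‖ω ζ - x‖ₑ ^ (-(p / 2))) arcMeasure :=
    (hω.sub aemeasurable_const).enorm.pow_const _
  calc ∫⁻ η : Circle, ‖xi ω ((r : ℂ) * η) x‖ₑ ^ p ∂arcMeasure
      ≤ ∫⁻ η : Circle, ∫⁻ ζ, ‖ω ζ - x‖ₑ ^ (-(p / 2)) * poisson ((r : ℂ) * η) ζ
          ∂arcMeasure ∂arcMeasure :=
        lintegral_mono fun η => enorm_xi_rpow_le hL hω hp (norm_ofReal_mul_circle_lt hr η)
    _ = ∫⁻ ζ, ∫⁻ η : Circle, ‖ω ζ - x‖ₑ ^ (-(p / 2)) * poisson ((r : ℂ) * η) ζ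
          ∂arcMeasure ∂arcMeasure :=
        lintegral_lintegral_swap (hm.comp_snd.mul (measurable_poisson_uncurry hr).aemeasurable)
    _ = ∫⁻ ζ, ‖ω ζ - x‖ₑ ^ (-(p / 2)) ∂arcMeasure := by
        refine lintegral_congr fun ζ => ?_
        simp_rw [poisson_comm r _ ζ]
        have hz := norm_ofReal_mul_circle_lt hr ζ
        rw [lintegral_const_mul _ (measurable_poisson hz), lintegral_poisson hz, mul_one]

theorem hasDerivAt_schwarzKernel_mul {z a : ℂ} (h : ‖z * a‖ < 1) :
    HasDerivAt (fun w => schwarzKernel (w * a)) (a * (2 / (1 - z * a) ^ 2)) z := by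
  have h0 := one_sub_ne_zero h
  have h1 : HasDerivAt (fun w : ℂ => w * a) a z := by
    simpa using (hasDerivAt_id z).mul_const a
  have h2 := (h1.const_add 1).div (h1.const_sub 1) h0
  refine h2.congr_deriv ?_
  field_simp
  ring

theorem differentiableOn_xi {x : ℝ}
    (hL : Integrable (fun ζ => Real.log |ω ζ - x|) arcMeasure) :
    DifferentiableOn ℂ (fun z => xi ω z x) (Metric.ball 0 1) := by
  intro z₀ hz₀
  rw [mem_ball_zero_iff] at hz₀
  refine DifferentiableAt.differentiableWithinAt ?_
  -- A radius strictly between `‖z₀‖` and one: on this disk `|1 - z ζ̄| ≥ 1 - ρ`, which dominates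
  -- the derivative of the kernel uniformly.
  set ρ : ℝ := (1 + ‖z₀‖) / 2 with hρ
  have hs : Metric.ball (0 : ℂ) ρ ∈ nhds z₀ :=
    Metric.isOpen_ball.mem_nhds (by rw [mem_ball_zero_iff]; linarith)
  have hlt : ∀ z ∈ Metric.ball (0 : ℂ) ρ, ‖z‖ < 1 := fun z hz => by
    rw [mem_ball_zero_iff] at hz
    linarith
  have hcont : Continuous fun ζ : Circle => conj (ζ : ℂ) * (2 / (1 - z₀ * conj (ζ : ℂ)) ^ 2) := by
    have hc : Continuous fun ζ : Circle => conj (ζ : ℂ) :=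
      Complex.continuous_conj.comp continuous_circle_coe
    exact hc.mul (continuous_const.div ((continuous_const.sub (continuous_const.mul hc)).pow 2)
      fun ζ => pow_ne_zero 2 (one_sub_ne_zero (norm_mul_conj_lt hz₀ ζ)))
  have key := hasDerivAt_integral_of_dominated_loc_of_deriv_le (μ := arcMeasure)
    (F := fun z (ζ : Circle) => (Real.log |ω ζ - x| : ℂ) * schwarzKernel (z * conj (ζ : ℂ)))
    (F' := fun z (ζ : Circle) => (Real.log |ω ζ - x| : ℂ) *
      (conj (ζ : ℂ) * (2 / (1 - z * conj (ζ : ℂ)) ^ 2)))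
    (bound := fun ζ => ‖Real.log |ω ζ - x|‖ * (2 / (1 - ρ) ^ 2)) hs
    (Filter.mem_of_superset hs fun z hz =>
      (integrable_log_mul_schwarzKernel hL (hlt z hz)).1)
    (integrable_log_mul_schwarzKernel hL hz₀)
    (hL.ofReal.1.mul hcont.aestronglyMeasurable)
    (Filter.Eventually.of_forall fun ζ z hz => ?_)
    (hL.norm.mul_const _)
    (Filter.Eventually.of_forall fun ζ z hz =>
      (hasDerivAt_schwarzKernel_mul (norm_mul_conj_lt (hlt z hz) ζ)).const_mul _)
  · exact (key.2.differentiableAt.const_mul _).cexp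
  · have hζ : ‖conj (ζ : ℂ)‖ = 1 := (Complex.norm_conj _).trans ζ.norm_coe
    rw [norm_mul, Complex.norm_real, norm_mul, hζ, one_mul, norm_div, norm_pow, Complex.norm_two]
    have h1 : 1 - ρ ≤ ‖1 - z * conj (ζ : ℂ)‖ := by
      have h2 := norm_sub_norm_le (1 : ℂ) (z * conj (ζ : ℂ))
      rw [norm_one, norm_mul, hζ, mul_one] at h2
      rw [mem_ball_zero_iff] at hz
      linarith
    have h3 : 0 < 1 - ρ := by linarith
    gcongr

/-! ### Arc endpoints and products of simple poles -/

theorem endpoints_mem_closure_openArc {a b : Circle} (hab : a ≠ b) :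
    a ∈ closure (openArc a b) ∧ b ∈ closure (openArc a b) := by
  have hpi := Real.pi_pos
  obtain ⟨s, hs⟩ : ∃ s : ℝ, Circle.exp s = a := ⟨_, Circle.exp_arg a⟩
  obtain ⟨t, hst, hts, ht⟩ : ∃ t : ℝ, s < t ∧ t < s + 2 * Real.pi ∧ Circle.exp t = b := by
    set θ := Complex.arg (b / a : Circle) with hθ
    have hexp : Circle.exp θ = b / a := Circle.exp_arg _
    have h0 : θ ≠ 0 := fun h => by
      rw [h, Circle.exp_zero, eq_comm, div_eq_one] at hexp
      exact hab hexp.symm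
    have h1 := Complex.neg_pi_lt_arg (b / a : Circle)
    have h2 := Complex.arg_le_pi (b / a : Circle)
    -- The principal argument of `b / a` lies in `(-π, π]` and is nonzero; a full turn is added when
    -- it is negative, to go counterclockwise.
    rcases lt_or_gt_of_ne h0 with h | h
    · refine ⟨s + (θ + 2 * Real.pi), by linarith, by linarith, ?_⟩
      rw [Circle.exp_add, Circle.exp_add_two_pi, hexp, hs, mul_div_cancel]
    · refine ⟨s + θ, by linarith, by linarith, ?_⟩
      rw [Circle.exp_add, hexp, hs, mul_div_cancel]
  have hsub : Circle.exp '' Ioo s t ⊆ openArc a b := by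
    rintro _ ⟨u, hu, rfl⟩
    exact ⟨s, t, u, hu.1, hu.2, hts, hs, ht, rfl⟩
  have hcl : Circle.exp '' Icc s t ⊆ closure (openArc a b) := by
    rw [← closure_Ioo hst.ne]
    exact (image_closure_subset_closure_image Circle.exp.continuous).trans (closure_mono hsub)
  exact ⟨hs ▸ hcl ⟨s, left_mem_Icc.2 hst.le, rfl⟩, ht ▸ hcl ⟨t, right_mem_Icc.2 hst.le, rfl⟩⟩

/-- The left endpoints of the arcs together with the `j`-th right endpoint. -/
def singularPoint {n : ℕ} (α β : Fin n → Circle) (j : Fin n) (i : Option (Fin n)) : Circle :=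
  i.elim (β j) α

theorem IsArcDecomposition.injective_singularPoint {Γ : Set Circle} {n : ℕ}
    {α β : Fin n → Circle} (h : IsArcDecomposition Γ α β) (j : Fin n) :
    Function.Injective (singularPoint α β j) := by
  have hα : ∀ l, α l ∈ closure (openArc (α l) (β l)) := fun l =>
    (endpoints_mem_closure_openArc (h.ne l)).1
  have hβ : ∀ l, β l ∈ closure (openArc (α l) (β l)) := fun l =>
    (endpoints_mem_closure_openArc (h.ne l)).2
  have hαβ : ∀ l, α l ≠ β j := fun l he => by
    rcases eq_or_ne l j with rfl | hlj
    · exact h.ne l he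
    · exact disjoint_left.1 (h.disjoint_closure l j hlj) (hα l) (he ▸ hβ j)
  rintro (_ | k) (_ | l) he
  · rfl
  · exact absurd he.symm (hαβ l)
  · exact absurd he (hαβ k)
  · by_contra hne
    have hkl : k ≠ l := fun hh => hne (congrArg some hh)
    have he' : α k = α l := he
    exact disjoint_left.1 (h.disjoint_closure k l hkl) (hα k) (he' ▸ hα l)

theorem norm_one_sub_mul_conj (z : ℂ) (a : Circle) : ‖1 - z * conj (a : ℂ)‖ = ‖z - a‖ := by
  have h : (a : ℂ) * conj (a : ℂ) = 1 := by
    rw [Complex.mul_conj, Circle.normSq_coe, Complex.ofReal_one]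
  have h1 : 1 - z * conj (a : ℂ) = (a - z) * conj (a : ℂ) := by rw [sub_mul, h]
  rw [h1, norm_mul, Complex.norm_conj, a.norm_coe, mul_one, norm_sub_rev]

/-- The triangle inequality for `a`, `z`, `b` divided by the three distances; it replaces a partial
fraction expansion. -/
theorem inv_norm_mul_inv_norm_le {z a b : ℂ} (ha : z ≠ a) (hb : z ≠ b) (hab : a ≠ b) :
    ‖z - b‖⁻¹ * ‖z - a‖⁻¹ ≤ ‖a - b‖⁻¹ * (‖z - a‖⁻¹ + ‖z - b‖⁻¹) := by
  have h1 : 0 < ‖z - a‖ := norm_pos_iff.2 (sub_ne_zero.2 ha)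
  have h2 : 0 < ‖z - b‖ := norm_pos_iff.2 (sub_ne_zero.2 hb)
  have h3 : 0 < ‖a - b‖ := norm_pos_iff.2 (sub_ne_zero.2 hab)
  have h4 : ‖a - b‖ ≤ ‖z - a‖ + ‖z - b‖ := by
    rw [norm_sub_rev z a]
    simpa using norm_add_le (a - z) (z - b)
  have h5 : ‖z - a‖⁻¹ + ‖z - b‖⁻¹ = (‖z - a‖ + ‖z - b‖) * (‖z - b‖⁻¹ * ‖z - a‖⁻¹) := by
    field_simp
    ring
  rw [h5, ← mul_assoc]
  refine le_mul_of_one_le_left (by positivity) ?_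
  rw [inv_mul_eq_div, one_le_div h3]
  exact h4

/-- A product of simple poles at distinct points is dominated by their sum. -/
theorem exists_prod_inv_norm_sub_le {ι : Type*} {a : ι → ℂ} (ha : Function.Injective a)
    (S : Finset ι) : ∃ C : ℝ, 0 ≤ C ∧ ∀ z : ℂ, (∀ i, z ≠ a i) →
      ∏ i ∈ S, ‖z - a i‖⁻¹ ≤ C * (1 + ∑ i ∈ S, ‖z - a i‖⁻¹) := by
  classical
  induction S using Finset.induction_on with
  | empty => exact ⟨1, zero_le_one, fun z _ => by simp⟩
  | insert k S hk ih =>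
    obtain ⟨C, hC, h⟩ := ih
    set D : ℝ := ∑ i ∈ S, ‖a i - a k‖⁻¹ with hD
    have hD0 : 0 ≤ D := Finset.sum_nonneg fun i _ => by positivity
    refine ⟨C * (1 + D + S.card * D), by positivity, fun z hz => ?_⟩
    rw [Finset.prod_insert hk, Finset.sum_insert hk]
    set u := ‖z - a k‖⁻¹ with hu
    set V := ∑ i ∈ S, ‖z - a i‖⁻¹ with hV
    have hu0 : 0 ≤ u := by positivity
    have hV0 : 0 ≤ V := Finset.sum_nonneg fun i _ => by positivity
    -- Each mixed product of the new pole with an old one is split into a sum. `D` bounds all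
    -- inverse distances from the new pole to the old ones.
    have h1 : u * V ≤ D * V + S.card * D * u := by
      have h2 : ∀ i ∈ S, u * ‖z - a i‖⁻¹ ≤ D * ‖z - a i‖⁻¹ + D * u := fun i hi => by
        have hik : a i ≠ a k := fun he => hk (ha he ▸ hi)
        refine (inv_norm_mul_inv_norm_le (hz i) (hz k) hik).trans ?_
        rw [mul_add]
        have h3 : ‖a i - a k‖⁻¹ ≤ D :=
          Finset.single_le_sum (f := fun i => ‖a i - a k‖⁻¹) (fun i _ => by positivity) hi
        gcongr
      calc u * V = ∑ i ∈ S, u * ‖z - a i‖⁻¹ := by rw [hV, Finset.mul_sum]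
        _ ≤ ∑ i ∈ S, (D * ‖z - a i‖⁻¹ + D * u) := Finset.sum_le_sum h2
        _ = D * V + S.card * D * u := by
          rw [Finset.sum_add_distrib, ← Finset.mul_sum, Finset.sum_const, nsmul_eq_mul]
          ring
    have hn : (0 : ℝ) ≤ S.card := Nat.cast_nonneg _
    calc u * ∏ i ∈ S, ‖z - a i‖⁻¹ ≤ u * (C * (1 + V)) := mul_le_mul_of_nonneg_left (h z hz) hu0
      _ = C * (u + u * V) := by ring
      _ ≤ C * ((1 + D + S.card * D) * (1 + (u + V))) := by
          refine mul_le_mul_of_nonneg_left ?_ hC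
          have e1 : 0 ≤ D * u := by positivity
          have e2 : 0 ≤ (S.card : ℝ) * D * V := by positivity
          have e3 : 0 ≤ (S.card : ℝ) * D := by positivity
          nlinarith
      _ = _ := by ring

/-! ### Estimates for the eigenfunctions -/

theorem norm_cpow_half {w : ℂ} (hw : w ≠ 0) : ‖w ^ (1 / 2 : ℂ)‖ = √‖w‖ := by
  rw [Complex.norm_cpow_of_ne_zero hw, Real.sqrt_eq_rpow]
  simp

theorem norm_cpow_neg_half {w : ℂ} (hw : w ≠ 0) : ‖w ^ (-(1 / 2) : ℂ)‖ = √(‖w‖⁻¹) := by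
  rw [Complex.cpow_neg, norm_inv, norm_cpow_half hw, Real.sqrt_inv]

theorem ne_circle_coe {z : ℂ} (hz : ‖z‖ < 1) (a : Circle) : z ≠ a := fun h => by
  rw [h, a.norm_coe] at hz
  exact lt_irrefl _ hz

/-- The simple pole at `β j` meets the half-order zero there and leaves an inverse square root, like
those at the `α l`. The other `β l` factors are at most `√2`, as `|z - β l| ≤ 2`. -/
theorem norm_eigenfunction_le {x : ℝ} {n : ℕ} (α β : Fin n → Circle) (j : Fin n) {z : ℂ}
    (hz : ‖z‖ < 1) :
    ‖eigenfunction ω x α β j z‖ ≤ √(coeffC α β j) * √2 ^ (Fintype.card (Fin n)) *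
      (‖xi ω z x‖ * √(∏ i, ‖z - singularPoint α β j i‖⁻¹)) := by
  have hne : ∀ a : Circle, 1 - z * conj (a : ℂ) ≠ 0 := fun a =>
    one_sub_ne_zero (norm_mul_conj_lt hz a)
  have hα : ∏ l, ‖(1 - z * conj (α l : ℂ)) ^ (-(1 / 2) : ℂ)‖ = ∏ l, √(‖z - α l‖⁻¹) :=
    Finset.prod_congr rfl fun l _ => by rw [norm_cpow_neg_half (hne _), norm_one_sub_mul_conj]
  have hβ : ∏ l, ‖(1 - z * conj (β l : ℂ)) ^ (1 / 2 : ℂ)‖ = ∏ l, √‖z - β l‖ :=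
    Finset.prod_congr rfl fun l _ => by rw [norm_cpow_half (hne _), norm_one_sub_mul_conj]
  have hle2 : ∀ l, √‖z - β l‖ ≤ √2 := fun l => Real.sqrt_le_sqrt (by
    have := norm_sub_le z (β l : ℂ)
    rw [(β l).norm_coe] at this
    linarith)
  have hpos : 0 < ‖z - β j‖ := norm_pos_iff.2 (sub_ne_zero.2 (ne_circle_coe hz _))
  have hprod : ‖z - β j‖⁻¹ * ∏ l, √‖z - β l‖ ≤ √(‖z - β j‖⁻¹) * √2 ^ (Fintype.card (Fin n)) := by
    rw [← Finset.mul_prod_erase Finset.univ _ (Finset.mem_univ j), ← mul_assoc]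
    have h1 : ‖z - β j‖⁻¹ * √‖z - β j‖ = √(‖z - β j‖⁻¹) := by
      have h2 := Real.mul_self_sqrt hpos.le
      have h3 := Real.sqrt_pos.2 hpos
      rw [Real.sqrt_inv]
      nth_rewrite 1 [← h2]
      field_simp
    rw [h1]
    refine mul_le_mul_of_nonneg_left ?_ (Real.sqrt_nonneg _)
    calc ∏ l ∈ Finset.univ.erase j, √‖z - β l‖ ≤ ∏ _l ∈ Finset.univ.erase j, √2 :=
          Finset.prod_le_prod (fun l _ => Real.sqrt_nonneg _) fun l _ => hle2 l
      _ = √2 ^ (Finset.univ.erase j).card := Finset.prod_const _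
      _ ≤ √2 ^ (Fintype.card (Fin n)) :=
          pow_le_pow_right₀ (Real.one_le_sqrt.2 one_le_two) (Finset.card_le_univ _)
  rw [eigenfunction, norm_mul, norm_mul, norm_mul, Complex.norm_real,
    Real.norm_of_nonneg (Real.sqrt_nonneg _), norm_inv, norm_one_sub_mul_conj, norm_prod]
  simp_rw [norm_mul]
  rw [Finset.prod_mul_distrib, hα, hβ, Fintype.prod_option,
    Real.sqrt_mul (by positivity), Real.sqrt_prod _ (fun l _ => by positivity)]
  have hA : 0 ≤ ∏ l, √(‖z - α l‖⁻¹) := Finset.prod_nonneg fun l _ => Real.sqrt_nonneg _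
  calc √(coeffC α β j) * ‖xi ω z x‖ * ‖z - β j‖⁻¹ * ((∏ l, √(‖z - α l‖⁻¹)) * ∏ l, √‖z - β l‖)
      = √(coeffC α β j) * ‖xi ω z x‖ * (∏ l, √(‖z - α l‖⁻¹)) *
          (‖z - β j‖⁻¹ * ∏ l, √‖z - β l‖) := by ring
    _ ≤ √(coeffC α β j) * ‖xi ω z x‖ * (∏ l, √(‖z - α l‖⁻¹)) *
          (√(‖z - β j‖⁻¹) * √2 ^ (Fintype.card (Fin n))) :=
        mul_le_mul_of_nonneg_left hprod (by positivity)
    _ = _ := by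
        simp only [singularPoint, Option.elim_none, Option.elim_some]
        ring

theorem exists_norm_eigenfunction_le (ω : Circle → ℝ) (x : ℝ) {Γ : Set Circle} {n : ℕ}
    {α β : Fin n → Circle} (h : IsArcDecomposition Γ α β) (j : Fin n) :
    ∃ M : ℝ, 0 ≤ M ∧ ∀ z : ℂ, ‖z‖ < 1 → ‖eigenfunction ω x α β j z‖
      ≤ M * (‖xi ω z x‖ ^ 2 + (1 + ∑ i, ‖z - singularPoint α β j i‖⁻¹)) := by
  obtain ⟨C, hC, hle⟩ := exists_prod_inv_norm_sub_le
    (Subtype.val_injective.comp (h.injective_singularPoint j)) Finset.univ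
  refine ⟨√(coeffC α β j) * √2 ^ (Fintype.card (Fin n)) * (1 + C), by positivity,
    fun z hz => (norm_eigenfunction_le α β j hz).trans ?_⟩
  rw [mul_assoc _ (1 + C)]
  refine mul_le_mul_of_nonneg_left ?_ (by positivity)
  set P := ∏ i, ‖z - singularPoint α β j i‖⁻¹ with hP
  set V := 1 + ∑ i, ‖z - singularPoint α β j i‖⁻¹ with hV
  have hP0 : 0 ≤ P := Finset.prod_nonneg fun i _ => by positivity
  have hV0 : 0 ≤ V := add_nonneg zero_le_one (Finset.sum_nonneg fun i _ => by positivity)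
  have hPV : P ≤ C * V := hle z fun i => ne_circle_coe hz _
  have hsq := Real.sq_sqrt hP0
  -- The product becomes a sum, so that the two factors can be integrated separately.
  have h1 : ‖xi ω z x‖ * √P ≤ ‖xi ω z x‖ ^ 2 + P := by
    nlinarith [sq_nonneg (‖xi ω z x‖ - √P), sq_nonneg (‖xi ω z x‖), sq_nonneg (√P)]
  have h2 : 0 ≤ C * ‖xi ω z x‖ ^ 2 := by positivity
  nlinarith

theorem ofReal_inv_norm_sub_rpow {z a : ℂ} (h : z ≠ a) (p : ℝ) :
    ENNReal.ofReal (‖z - a‖⁻¹) ^ p = ‖z - a‖ₑ ^ (-p) := by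
  have h1 : 0 < ‖z - a‖ := norm_pos_iff.2 (sub_ne_zero.2 h)
  rw [ENNReal.ofReal_inv_of_pos h1, ofReal_norm, ENNReal.inv_rpow, ENNReal.rpow_neg]

theorem rpow_sum_le_sum_rpow {ι : Type*} (S : Finset ι) (f : ι → ENNReal) {p : ℝ} (hp0 : 0 < p)
    (hp1 : p ≤ 1) : (∑ i ∈ S, f i) ^ p ≤ ∑ i ∈ S, f i ^ p :=
  Finset.le_sum_of_subadditive (fun t : ENNReal => t ^ p) (ENNReal.zero_rpow_of_pos hp0).le
    (fun a b => ENNReal.rpow_add_le_add_rpow a b hp0.le hp1) S f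

/-- On the circle `|rζ - a| = |1 - r ā ζ|`, which reduces this to a simple pole, with a bound
independent of `r` and `a`. -/
theorem lintegral_enorm_sub_circle_rpow_le {p : ℝ} (hp0 : 0 < p) (hp1 : p < 1) {r : ℝ}
    (hr : r ∈ Ico (0 : ℝ) 1) (a : Circle) :
    ∫⁻ ζ : Circle, ‖(r : ℂ) * ζ - a‖ₑ ^ (-p) ∂arcMeasure
      ≤ ENNReal.ofReal (Real.cos (p * (Real.pi / 2)))⁻¹ := by
  refine le_of_eq_of_le (lintegral_congr fun ζ => ?_) (lintegral_one_sub_rpow_le hp0 hp1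
    (w := (r : ℂ) * conj (a : ℂ)) (norm_mul_coe_lt
      (by rw [Complex.norm_real, Real.norm_of_nonneg hr.1]; exact hr.2)
      ((Complex.norm_conj _).trans a.norm_coe).le))
  rw [← ofReal_norm, ← ofReal_norm, ← norm_one_sub_mul_conj]
  congr 4
  ring

theorem measurable_enorm_sub_circle_rpow (p r : ℝ) (a : Circle) :
    Measurable fun ζ : Circle => ‖(r : ℂ) * ζ - a‖ₑ ^ (-p) :=
  ((continuous_const.mul continuous_circle_coe).sub continuous_const).measurable.enorm.pow_const _

theorem enorm_eigenfunction_rpow_le {x : ℝ} {n : ℕ} {α β : Fin n → Circle} {j : Fin n} {M : ℝ}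
    {z : ℂ} (hz : ‖z‖ < 1) (hle : ‖eigenfunction ω x α β j z‖
      ≤ M * (‖xi ω z x‖ ^ 2 + (1 + ∑ i, ‖z - singularPoint α β j i‖⁻¹))) (hM : 0 ≤ M)
    {p : ℝ} (hp0 : 0 < p) (hp1 : p < 1) :
    ‖eigenfunction ω x α β j z‖ₑ ^ p ≤ ENNReal.ofReal M ^ p *
      (‖xi ω z x‖ₑ ^ (2 * p) + (1 + ∑ i, ‖z - singularPoint α β j i‖ₑ ^ (-p))) := by
  have h := ENNReal.ofReal_le_ofReal hle
  have hS : 0 ≤ ∑ i, ‖z - singularPoint α β j i‖⁻¹ := Finset.sum_nonneg fun i _ => by positivity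
  rw [ENNReal.ofReal_mul hM, ENNReal.ofReal_add (by positivity) (by positivity),
    ENNReal.ofReal_add zero_le_one hS, ENNReal.ofReal_one,
    ENNReal.ofReal_sum_of_nonneg (fun i _ => by positivity), ofReal_norm,
    ENNReal.ofReal_pow (norm_nonneg _), ofReal_norm] at h
  refine (ENNReal.rpow_le_rpow h hp0.le).trans ?_
  rw [ENNReal.mul_rpow_of_nonneg _ _ hp0.le]
  refine mul_le_mul_right ?_ _
  refine (ENNReal.rpow_add_le_add_rpow _ _ hp0.le hp1.le).trans (add_le_add ?_ ?_)
  · rw [ENNReal.rpow_mul, ENNReal.rpow_ofNat]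
  · refine (ENNReal.rpow_add_le_add_rpow _ _ hp0.le hp1.le).trans (add_le_add ?_ ?_)
    · rw [ENNReal.one_rpow]
    · refine (rpow_sum_le_sum_rpow _ _ hp0 hp1.le).trans (Finset.sum_le_sum fun i _ => ?_)
      rw [ofReal_inv_norm_sub_rpow (ne_circle_coe hz _)]

theorem differentiableOn_eigenfunction {x : ℝ}
    (hL : Integrable (fun ζ => Real.log |ω ζ - x|) arcMeasure) {n : ℕ} (α β : Fin n → Circle)
    (j : Fin n) : DifferentiableOn ℂ (eigenfunction ω x α β j) (Metric.ball 0 1) := by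
  have hd : ∀ a : Circle, DifferentiableOn ℂ (fun z => 1 - z * conj (a : ℂ)) (Metric.ball 0 1) :=
    fun a => by fun_prop
  have hslit : ∀ a : Circle, ∀ z ∈ Metric.ball (0 : ℂ) 1, 1 - z * conj (a : ℂ) ∈ Complex.slitPlane :=
    fun a z hz => one_sub_mem_slitPlane (norm_mul_conj_lt (mem_ball_zero_iff.1 hz) a)
  refine ((((differentiableOn_const _).mul (differentiableOn_xi hL)).mul
    ((hd _).inv fun z hz => Complex.slitPlane_ne_zero (hslit _ z hz))).mul ?_)
  exact DifferentiableOn.fun_finsetProd fun l _ =>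
    ((hd _).cpow_const (hslit _)).mul ((hd _).cpow_const (hslit _))

theorem memHardy_eigenfunction {x : ℝ} (hω : AEMeasurable ω arcMeasure)
    (hL : Integrable (fun ζ => Real.log |ω ζ - x|) arcMeasure) {Γ : Set Circle} {n : ℕ}
    {α β : Fin n → Circle} (h : IsArcDecomposition Γ α β) (j : Fin n) {p : ℝ} (hp0 : 0 < p)
    (hp1 : p < 1) (hfin : ∫⁻ ζ, ‖ω ζ - x‖ₑ ^ (-p) ∂arcMeasure < ⊤) :
    MemHardy p (eigenfunction ω x α β j) := by
  refine ⟨differentiableOn_eigenfunction hL α β j, ?_⟩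
  obtain ⟨M, hM, hle⟩ := exists_norm_eigenfunction_le ω x h j
  set K := ENNReal.ofReal (Real.cos (p * (Real.pi / 2)))⁻¹
  have hbound : ∀ r ∈ Ico (0 : ℝ) 1,
      ∫⁻ ζ : Circle, ‖eigenfunction ω x α β j ((r : ℂ) * ζ)‖ₑ ^ p ∂arcMeasure
        ≤ ENNReal.ofReal M ^ p * ((∫⁻ ζ, ‖ω ζ - x‖ₑ ^ (-p) ∂arcMeasure) +
          (1 + ∑ _i : Option (Fin n), K)) := by
    intro r hr
    have hMtop : ENNReal.ofReal M ^ p ≠ ⊤ :=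
      ENNReal.rpow_ne_top_of_nonneg hp0.le ENNReal.ofReal_ne_top
    have hmeas := fun i => measurable_enorm_sub_circle_rpow p r (singularPoint α β j i)
    refine (lintegral_mono fun ζ => enorm_eigenfunction_rpow_le (norm_ofReal_mul_circle_lt hr ζ)
      (hle _ (norm_ofReal_mul_circle_lt hr ζ)) hM hp0 hp1).trans ?_
    rw [lintegral_const_mul' _ _ hMtop]
    refine mul_le_mul_right ?_ _
    have hsum : Measurable fun ζ : Circle =>
        1 + ∑ i, ‖(r : ℂ) * ζ - singularPoint α β j i‖ₑ ^ (-p) :=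
      measurable_const.add (Finset.measurable_fun_sum _ fun i _ => hmeas i)
    rw [lintegral_add_right _ hsum,
      lintegral_add_left measurable_const, lintegral_const, measure_univ, mul_one,
      lintegral_finsetSum _ fun i _ => hmeas i]
    refine add_le_add ?_ (add_le_add le_rfl (Finset.sum_le_sum fun i _ =>
      lintegral_enorm_sub_circle_rpow_le hp0 hp1 hr _))
    -- The square of `|ξ|` doubles the exponent and Jensen halves it again, leaving `|ω - x|^(-p)`.
    have hxi := lintegral_enorm_xi_rpow_le hL hω (p := 2 * p) (by positivity) hr
    rwa [mul_div_cancel_left₀ p two_ne_zero] at hxi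
  refine (iSup₂_le hbound).trans_lt (ENNReal.mul_lt_top ?_ ?_)
  · exact ENNReal.rpow_lt_top_of_nonneg hp0.le ENNReal.ofReal_ne_top
  · refine ENNReal.add_lt_top.2 ⟨hfin, ENNReal.add_lt_top.2 ⟨ENNReal.one_lt_top, ?_⟩⟩
    exact ENNReal.sum_lt_top.2 fun i _ => ENNReal.ofReal_lt_top

end ToeplitzEigen

end

theorem theorem5p9 (ω : Circle → ℝ) (hω : ToeplitzEigen.IsSymbol ω)
    (Λ : Set ℝ) (hΛ : Λ.OrdConnected)
    (hΛγ : ∀ x ∈ Λ, ToeplitzEigen.gammaOne ω < (x : EReal) ∧ (x : EReal) < ToeplitzEigen.gammaTwo ω)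
    (m : ℝ → ℕ) (α β : ∀ x : ℝ, Fin (m x) → Circle)
    (hΓ : ∀ᵐ x ∂(volume.restrict Λ),
      ToeplitzEigen.IsArcDecomposition (ToeplitzEigen.sublevel ω x) (α x) (β x)) :
    (∀ p : ℝ, 0 < p → p < 2 → ∀ X : Set ℝ, X.OrdConnected → Bornology.IsBounded X →
      (⨆ z ∈ Metric.ball (0 : ℂ) 1, ∫⁻ x in X, ‖ToeplitzEigen.xi ω z x‖ₑ ^ p) < ⊤) ∧
    ∀ᵐ x ∂(volume.restrict Λ),
      Integrable (fun ζ => Real.log |ω ζ - x|) ToeplitzEigen.arcMeasure ∧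
      ∀ p : ℝ, 0 < p → p < 1 → ∀ j : Fin (m x),
        ToeplitzEigen.MemHardy p (ToeplitzEigen.eigenfunction ω x (α x) (β x) j) := by
  refine ⟨fun p hp0 hp2 X _ hXb => ?_, ?_⟩
  · refine (iSup₂_le fun z hz => ToeplitzEigen.setLIntegral_enorm_xi_rpow_le hω.integrable hp0
      (mem_ball_zero_iff.1 hz) X).trans_lt (ENNReal.add_lt_top.2
        ⟨ToeplitzEigen.lintegral_Icc_enorm_rpow_lt_top (by linarith), hXb.measure_lt_top⟩)
  · have hm := hω.integrable.1.aemeasurable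
    filter_upwards [hΓ, ae_restrict_of_ae
      (ToeplitzEigen.ae_forall_lintegral_enorm_sub_rpow_lt_top hm)] with x hx hfin
    have hL := ToeplitzEigen.integrable_log_abs_sub hω.integrable
      (hfin _ (by norm_num) (by norm_num))
    exact ⟨hL, fun p hp0 hp1 j =>
      ToeplitzEigen.memHardy_eigenfunction hm hL hx j hp0 hp1 (hfin p hp0.le hp1)⟩
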